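/- All digraphs are finite, without loops or multiple arcs. For a strongly connected digraph $G$ let $D(G)$ be its distance matrix, whose $(u,v)$ entry is the length of a shortest directed path from $u$ to $v$, and let $\lambda_1(D(G))$ be the largest modulus of an eigenvalue of $D(G)$ (the distance spectral radius). The essential connectivity of $G$ is the minimum size of a set $S$ of vertices such that $G-S$ has at least two non-trivial strongly connected components, a component being non-trivial if it contains at least one arc. Let $n,k$ be integers with $k\ge 1$ and $n\ge k+4$, and let $\mathcal D_{n,k}$ be the set of strongly connected digraphs on $n$ vertices with essential connectivity $k$. For $2\le n_1\le n-k-2$ let $G_n^{k,n_1}$ be the digraph whose vertex set is the disjoint union of sets $A,B,C$ with $|A|=k$, $|B|=n_1$, $|C|=n-k-n_1$, and whose arcs are all ordered pairs of distinct vertices except those from $C$ to $B$. **Theorem.** The digraphs $G_n^{k,2}$ and $G_n^{k,n-k-2}$ belong to $\mathcal D_{n,k}$, and for every $G\in\mathcal D_{n,k}$, $$\lambda_1(D(G))\ \ge\ \frac{n-2+\sqrt{(n-2)^2+12n-8k-20}}{2},$$ with equality if and only if $G$ is isomorphic to $G_n^{k,2}$ or to $G_n^{k,n-k-2}$. -/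

import Mathlib

namespace Digraph

/-- The digraph has no loops. (A `Digraph` has no multiple arcs by construction.) -/
def IsLoopless {V : Type*} (G : Digraph V) : Prop :=
  ∀ v, ¬ G.Adj v v

/-- `G.HasWalk m u v`: there is a directed walk with exactly `m` arcs from `u` to `v`. -/
def HasWalk {V : Type*} (G : Digraph V) : ℕ → V → V → Prop
  | 0, u, v => u = v
  | m + 1, u, v => ∃ w, G.Adj u w ∧ G.HasWalk m w v

/-- `v` can be reached from `u` along arcs of `G`. -/
def Reaches {V : Type*} (G : Digraph V) (u v : V) : Prop :=
  ∃ m, G.HasWalk m u v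

/-- Every vertex can be reached from every vertex. -/
def IsStronglyConnected {V : Type*} (G : Digraph V) : Prop :=
  ∀ u v, G.Reaches u v

/-- The length of a shortest directed walk (equivalently, of a shortest directed path)
from `u` to `v`. It is used for strongly connected digraphs, where such a walk exists. -/
noncomputable def distance {V : Type*} (G : Digraph V) (u v : V) : ℕ :=
  sInf {m | G.HasWalk m u v}

/-- The distance matrix, with complex entries so that all its eigenvalues are available. -/
noncomputable def distanceMatrix {V : Type*} (G : Digraph V) : Matrix V V ℂ :=
  Matrix.of fun u v => (G.distance u v : ℂ)

open Classical in
/-- The distance spectral radius: the largest modulus of a complex eigenvalue of the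
distance matrix. -/
noncomputable def distanceSpectralRadius {V : Type*} [Fintype V] (G : Digraph V) : ℝ :=
  (spectralRadius ℂ G.distanceMatrix).toReal

/-- The subdigraph induced on a set of vertices. -/
def induceOn {V : Type*} (G : Digraph V) (s : Set V) : Digraph s where
  Adj u v := G.Adj u v

/-- `C` is the vertex set of a strongly connected component of `G`. -/
def IsStrongComponent {V : Type*} (G : Digraph V) (C : Set V) : Prop :=
  ∃ v, C = {u | G.Reaches v u ∧ G.Reaches u v}

/-- The subdigraph induced on `C` is non-trivial: it has an arc that is not a loop. -/
def IsNontrivialOn {V : Type*} (G : Digraph V) (C : Set V) : Prop :=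
  ∃ u ∈ C, ∃ v ∈ C, u ≠ v ∧ G.Adj u v

/-- `G - S` has at least two non-trivial strongly connected components. -/
def IsEssentialCut {V : Type*} (G : Digraph V) (S : Finset V) : Prop :=
  ∃ C₁ C₂ : Set {v : V | v ∉ S}, C₁ ≠ C₂ ∧
    (G.induceOn {v | v ∉ S}).IsStrongComponent C₁ ∧
    (G.induceOn {v | v ∉ S}).IsStrongComponent C₂ ∧
    (G.induceOn {v | v ∉ S}).IsNontrivialOn C₁ ∧
    (G.induceOn {v | v ∉ S}).IsNontrivialOn C₂

/-- The least size of an essential vertex cut; it is `⊤` if there is no such cut. -/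
noncomputable def essentialConnectivity {V : Type*} (G : Digraph V) : ℕ∞ :=
  sInf {m | ∃ S : Finset V, G.IsEssentialCut S ∧ m = (S.card : ℕ∞)}

/-- `G` is a strongly connected (loopless) digraph on `n` vertices with essential
connectivity `k`. -/
structure MemClass {V : Type*} [Fintype V] (n k : ℕ) (G : Digraph V) : Prop where
  loopless : G.IsLoopless
  card_eq : Fintype.card V = n
  stronglyConnected : G.IsStronglyConnected
  essentialConnectivity_eq : G.essentialConnectivity = (k : ℕ∞)

/-- The complete (loopless) digraph on the vertices `0, …, m - 1`. -/
def completeOn (m : ℕ) : Digraph (Fin m) where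
  Adj u v := u ≠ v

/-- The disjoint union of two digraphs. -/
def disjUnion {V W : Type*} (G : Digraph V) (H : Digraph W) : Digraph (V ⊕ W) where
  Adj := Sum.LiftRel G.Adj H.Adj

/-- The disjoint union together with all arcs, in both directions, between the two parts. -/
def join {V W : Type*} (G : Digraph V) (H : Digraph W) : Digraph (V ⊕ W) :=
  disjUnion G H ⊔ completeBipartiteGraph V W

/-- The digraph consisting of all arcs from the second part to the third part. -/
def forwardArcs (U V W : Type*) : Digraph (U ⊕ (V ⊕ W)) where
  Adj x y := ∃ (v : V) (w : W), x = Sum.inr (Sum.inl v) ∧ y = Sum.inr (Sum.inr w)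

/-- The join of `K_k` with the disjoint union of `K_{n₁}` and `K_{n-k-n₁}`, together with all
arcs from `K_{n₁}` to `K_{n-k-n₁}`. -/
def extremal (n k n₁ : ℕ) : Digraph (Fin k ⊕ (Fin n₁ ⊕ Fin (n - k - n₁))) :=
  join (completeOn k) (disjUnion (completeOn n₁) (completeOn (n - k - n₁))) ⊔
    forwardArcs (Fin k) (Fin n₁) (Fin (n - k - n₁))

/-- Two digraphs are isomorphic. -/
def IsIsomorphic {V W : Type*} (G : Digraph V) (H : Digraph W) : Prop :=
  Nonempty (G.Adj ≃r H.Adj)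

end Digraph

/-! ### Collatz–Wielandt bounds for nonnegative matrices. -/

section NonnegativeMatrix

open Matrix Filter Topology
open scoped NNReal ENNReal

variable {V : Type*} [Fintype V]

/-! Let `S` be an essential cut of size k. Of two non-trivial components of G - S, one, say that of
`v₂`, cannot reach the other. Let C be the part of G - S reachable from `v₂`, and B the rest. No arc
goes from C to B, and both have at least two vertices, so G is a spanning subdigraph of `extremal n
k b` with b = |B| (`MemClass.exists_iso_le_extremal`).

Deleting an arc lowers no distance and raises one from 1 to at least 2, so the spectral radius grows
strictly (`lt_distanceSpectralRadius_of_lt`).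

The distance matrix of `extremal n k b` is J - I + 1_C 1_Bᵀ. An explicit positive eigenvector shows
that its spectral radius μ satisfies (μ+1)² = n(μ+1) + p with p = b(n-k-b)
(`extremal_mulVec_extremalVec`). This μ increases with p, and p is least over 2 ≤ b ≤ n-k-2 exactly
at the two ends. -/

theorem Matrix.mulVec_mono_of_nonneg {A : Matrix V V ℝ} (hA : ∀ i j, 0 ≤ A i j) {x y : V → ℝ}
    (h : ∀ i, x i ≤ y i) (i : V) : (A *ᵥ x) i ≤ (A *ᵥ y) i :=
  Finset.sum_le_sum fun j _ => mul_le_mul_of_nonneg_left (h j) (hA i j)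

variable [DecidableEq V]

theorem Matrix.pow_mulVec_ge {A : Matrix V V ℝ} (hA : ∀ i j, 0 ≤ A i j) {y : V → ℝ} {μ : ℝ}
    (hμ : 0 ≤ μ) (h : ∀ i, μ * y i ≤ (A *ᵥ y) i) (m : ℕ) (i : V) :
    μ ^ m * y i ≤ ((A ^ m) *ᵥ y) i := by
  induction m generalizing i with
  | zero => simp
  | succ m ih =>
    rw [pow_succ' A, ← Matrix.mulVec_mulVec]
    calc μ ^ (m + 1) * y i = μ ^ m * (μ * y i) := by ring
      _ ≤ μ ^ m * (A *ᵥ y) i := mul_le_mul_of_nonneg_left (h i) (by positivity)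
      _ = (A *ᵥ (μ ^ m • y)) i := by rw [Matrix.mulVec_smul]; rfl
      _ ≤ _ := Matrix.mulVec_mono_of_nonneg hA (fun j => by simpa using ih j) i

/-- Needed because `toReal` sends ∞ to 0, which would void lower bounds. -/
theorem Matrix.spectralRadius_ne_top (A : Matrix V V ℂ) : spectralRadius ℂ A ≠ ∞ := by
  let := Matrix.linftyOpNormedRing (n := V) (α := ℂ)
  let := Matrix.linftyOpNormedAlgebra (R := ℂ) (n := V) (α := ℂ)
  by_cases hV : Nonempty V
  · exact ((spectrum.spectralRadius_le_nnnorm (𝕜 := ℂ) A).trans_lt ENNReal.coe_lt_top).ne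
  · rw [not_nonempty_iff] at hV
    have : Subsingleton (Matrix V V ℂ) := ⟨fun a b => by ext i; exact (hV.false i).elim⟩
    rw [spectrum.SpectralRadius.of_subsingleton]
    simp

/-- A lower Collatz–Wielandt bound: a nonnegative matrix with `μ y ≤ A y` for some positive `y`
has spectral radius at least `μ`. -/
theorem Matrix.le_spectralRadius_of_le_mulVec [Nonempty V] {A : Matrix V V ℝ}
    (hA : ∀ i j, 0 ≤ A i j) {y : V → ℝ} (hy : ∀ i, 0 < y i) {μ : ℝ} (hμ : 0 ≤ μ)
    (h : ∀ i, μ * y i ≤ (A *ᵥ y) i) :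
    μ ≤ (spectralRadius ℂ (A.map Complex.ofReal)).toReal := by
  let := Matrix.linftyOpNormedRing (n := V) (α := ℂ)
  let := Matrix.linftyOpNormedAlgebra (R := ℂ) (n := V) (α := ℂ)
  have hnorm : ∀ m : ℕ, μ ^ m ≤ ‖(A.map Complex.ofReal) ^ m‖ := by
    intro m
    -- At a maximal coordinate `y i` is the sup norm of `y`, so the growth of `A ^ m` on `y` bounds
    -- its operator norm. Gelfand's formula then concludes.
    obtain ⟨i, hi⟩ := Finite.exists_max y
    set z : V → ℂ := fun i => (y i : ℂ)
    have hz : ‖z‖ ≤ y i := (pi_norm_le_iff_of_nonneg (hy i).le).2 fun j => by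
      simpa [z, abs_of_pos (hy j)] using hi j
    have hmap : ((A.map Complex.ofReal) ^ m *ᵥ z) i = (((A ^ m) *ᵥ y) i : ℝ) := by
      have : (A.map Complex.ofReal) ^ m = (A ^ m).map Complex.ofReal :=
        (map_pow (Complex.ofRealHom.mapMatrix (m := V)) A m).symm
      rw [this]
      simp [Matrix.mulVec, dotProduct, z]
    have h1 := norm_le_pi_norm ((A.map Complex.ofReal) ^ m *ᵥ z) i
    have h2 := Matrix.linfty_opNorm_mulVec ((A.map Complex.ofReal) ^ m) z
    have h3 := Matrix.pow_mulVec_ge hA hμ h m i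
    rw [hmap, Complex.norm_real] at h1
    have h4 := le_abs_self (((A ^ m) *ᵥ y) i)
    rw [Real.norm_eq_abs] at h1
    have h5 := mul_le_mul_of_nonneg_left hz (norm_nonneg ((A.map Complex.ofReal) ^ m))
    exact le_of_mul_le_mul_right (by linarith) (hy i)
  have hlim := spectrum.pow_nnnorm_pow_one_div_tendsto_nhds_spectralRadius (A.map Complex.ofReal)
  have hle : ENNReal.ofReal μ ≤ spectralRadius ℂ (A.map Complex.ofReal) := by
    refine ge_of_tendsto hlim ?_
    filter_upwards [eventually_gt_atTop 0] with m hm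
    have hm' : (m : ℝ) ≠ 0 := by positivity
    have : ENNReal.ofReal μ ^ m ≤ (‖(A.map Complex.ofReal) ^ m‖₊ : ℝ≥0∞) := by
      rw [← ENNReal.ofReal_pow hμ, ← enorm_eq_nnnorm, ← ofReal_norm]
      exact ENNReal.ofReal_le_ofReal (hnorm m)
    calc ENNReal.ofReal μ = (ENNReal.ofReal μ ^ m) ^ (1 / m : ℝ) := by
          rw [← ENNReal.rpow_natCast, ← ENNReal.rpow_mul, mul_one_div_cancel hm', ENNReal.rpow_one]
      _ ≤ _ := ENNReal.rpow_le_rpow this (by positivity)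
  exact (ENNReal.ofReal_le_iff_le_toReal (Matrix.spectralRadius_ne_top _)).1 hle

/-- An upper Collatz–Wielandt bound: a nonnegative matrix with `A y ≤ μ y` for some positive `y`
has spectral radius at most `μ`. -/
theorem Matrix.spectralRadius_le_of_mulVec_le {A : Matrix V V ℝ}
    (hA : ∀ i j, 0 ≤ A i j) {y : V → ℝ} (hy : ∀ i, 0 < y i) {μ : ℝ} (hμ : 0 ≤ μ)
    (h : ∀ i, (A *ᵥ y) i ≤ μ * y i) :
    (spectralRadius ℂ (A.map Complex.ofReal)).toReal ≤ μ := by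
  refine ENNReal.toReal_le_of_le_ofReal hμ (iSup₂_le fun z hz => ?_)
  rw [← enorm_eq_nnnorm, ← ofReal_norm]
  refine ENNReal.ofReal_le_ofReal ?_
  rw [← Matrix.spectrum_toLin', ← Module.End.hasEigenvalue_iff_mem_spectrum] at hz
  obtain ⟨x, hx⟩ := hz.exists_hasEigenvector
  have hx0 := hx.2
  have hxe : (A.map Complex.ofReal) *ᵥ x = z • x := by simpa using hx.apply_eq_smul
  obtain ⟨j, hj⟩ := Function.ne_iff.1 hx0
  have : Nonempty V := ⟨j⟩
  -- With r the largest ratio, |x| ≤ r y with equality at `i`; row `i` of the eigenvalue equation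
  -- gives the bound.
  obtain ⟨i, hi⟩ := Finite.exists_max fun i => ‖x i‖ / y i
  have hxj : 0 < ‖x j‖ / y j := div_pos (norm_pos_iff.2 hj) (hy j)
  set r := ‖x i‖ / y i with hr
  have hr0 : 0 < r := hxj.trans_le (hi j)
  have hri : ‖x i‖ = r * y i := (div_mul_cancel₀ _ (hy i).ne').symm
  have hxi : 0 < ‖x i‖ := hri ▸ mul_pos hr0 (hy i)
  refine le_of_mul_le_mul_right ?_ hxi
  calc ‖z‖ * ‖x i‖ = ‖((A.map Complex.ofReal) *ᵥ x) i‖ := by rw [hxe]; simp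
    _ ≤ ∑ l, ‖(A i l : ℂ) * x l‖ := norm_sum_le _ _
    _ ≤ ∑ l, A i l * (r * y l) := by
        refine Finset.sum_le_sum fun l _ => ?_
        rw [norm_mul, Complex.norm_real, Real.norm_of_nonneg (hA i l)]
        exact mul_le_mul_of_nonneg_left ((div_le_iff₀ (hy l)).1 (hi l)) (hA i l)
    _ = r * (A *ᵥ y) i := by
        rw [Matrix.mulVec, dotProduct, Finset.mul_sum]
        exact Finset.sum_congr rfl fun l _ => by ring
    _ ≤ r * (μ * y i) := mul_le_mul_of_nonneg_left (h i) hr0.le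
    _ = μ * ‖x i‖ := by rw [hri]; ring

/-- The strict form of the lower bound, for matrices with positive off-diagonal entries. -/
theorem Matrix.lt_spectralRadius_of_le_mulVec {A : Matrix V V ℝ}
    (hA : ∀ i j, 0 ≤ A i j) (hA' : ∀ i j, i ≠ j → 0 < A i j) (hV : 3 ≤ Fintype.card V)
    {y : V → ℝ} (hy : ∀ i, 0 < y i) {μ : ℝ} (hμ : 0 ≤ μ)
    (h : ∀ i, μ * y i ≤ (A *ᵥ y) i) {u : V} (hu : μ * y u < (A *ᵥ y) u) :
    μ < (spectralRadius ℂ (A.map Complex.ofReal)).toReal := by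
  have : Nonempty V := ⟨u⟩
  have hpos : ∀ x : V → ℝ, (∀ i, 0 ≤ x i) → ∀ i j, i ≠ j → 0 < x j → 0 < (A *ᵥ x) i := by
    intro x hx i j hij hj
    refine lt_of_lt_of_le (mul_pos (hA' i j hij) hj) ?_
    exact Finset.single_le_sum (f := fun l => A i l * x l)
      (fun l _ => mul_nonneg (hA i l) (hx l)) (Finset.mem_univ j)
  have hnn : ∀ x : V → ℝ, (∀ i, 0 ≤ x i) → ∀ i, 0 ≤ (A *ᵥ x) i := fun x hx i =>
    Finset.sum_nonneg fun l _ => mul_nonneg (hA i l) (hx l)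
  have hother : ∀ i j : V, ∃ l, l ≠ i ∧ l ≠ j := by
    intro i j
    have hlt : ({i, j} : Finset V).card < Fintype.card V :=
      lt_of_le_of_lt (Finset.card_le_two) (by omega)
    obtain ⟨l, -, hl⟩ := Finset.exists_mem_notMem_of_card_lt_card (t := Finset.univ) hlt
    exact ⟨l, by simp at hl; tauto⟩
  -- The defect `w` is nonnegative and positive at `u`. The diagonal of `A` may vanish, so two
  -- applications of `A` spread positivity to every coordinate, through an index other than `i` and
  -- `u`; three vertices are needed for this. Then A²y satisfies the bound with μ + ε.
  set w : V → ℝ := A *ᵥ y - μ • y with hw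
  have hw0 : ∀ i, 0 ≤ w i := fun i => by simpa [hw] using h i
  have hwu : 0 < w u := by simpa [hw] using hu
  set z : V → ℝ := A *ᵥ (A *ᵥ y)
  have hz : ∀ i, 0 < z i := by
    have h1 : ∀ i, 0 < (A *ᵥ y) i := fun i => by
      obtain ⟨l, hl, -⟩ := hother i i
      exact hpos y (fun i => (hy i).le) i l hl.symm (hy l)
    intro i
    obtain ⟨l, hl, -⟩ := hother i i
    exact hpos _ (fun i => (h1 i).le) i l hl.symm (h1 l)
  have hzw : A *ᵥ z - μ • z = A *ᵥ (A *ᵥ w) := by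
    simp [hw, z, Matrix.mulVec_sub, Matrix.mulVec_smul]
  have hw2 : ∀ i, 0 < (A *ᵥ (A *ᵥ w)) i := by
    intro i
    obtain ⟨l, hli, hlu⟩ := hother i u
    exact hpos _ (hnn w hw0) i l hli.symm (hpos w hw0 l u hlu hwu)
  obtain ⟨i, hi⟩ := Finite.exists_min fun i => (A *ᵥ (A *ᵥ w)) i / z i
  set ε := (A *ᵥ (A *ᵥ w)) i / z i
  have hε : 0 < ε := div_pos (hw2 i) (hz i)
  have hle : μ + ε ≤ (spectralRadius ℂ (A.map Complex.ofReal)).toReal := by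
    refine Matrix.le_spectralRadius_of_le_mulVec hA hz (by positivity) fun j => ?_
    have h1 := (le_div_iff₀ (hz j)).1 (hi j)
    have h2 := congrFun hzw j
    simp only [Pi.sub_apply, Pi.smul_apply, smul_eq_mul] at h2
    linarith
  linarith

end NonnegativeMatrix

namespace Digraph

/-! ### Walks, reachability and distance. -/

section Walks

variable {V W : Type*} {G : Digraph V} {H : Digraph W}

theorem HasWalk.append {l m : ℕ} {u v w : V} (h₁ : G.HasWalk l u v) (h₂ : G.HasWalk m v w) :
    G.HasWalk (l + m) u w := by
  induction l generalizing u with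
  | zero =>
    obtain rfl : u = v := h₁
    simpa using h₂
  | succ l ih =>
    obtain ⟨x, hx, hxv⟩ := h₁
    rw [Nat.succ_add]
    exact ⟨x, hx, ih hxv⟩

theorem Reaches.refl (u : V) : G.Reaches u u := ⟨0, rfl⟩

theorem Reaches.of_adj {u v : V} (h : G.Adj u v) : G.Reaches u v := ⟨1, v, h, rfl⟩

theorem Reaches.trans {u v w : V} (h₁ : G.Reaches u v) (h₂ : G.Reaches v w) : G.Reaches u w := by
  obtain ⟨l, hl⟩ := h₁
  obtain ⟨m, hm⟩ := h₂
  exact ⟨l + m, hl.append hm⟩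

theorem Reaches.mem_of_closed {P : V → Prop} (hP : ∀ u v, P u → G.Adj u v → P v) {u v : V}
    (h : G.Reaches u v) (hu : P u) : P v := by
  obtain ⟨m, hm⟩ := h
  induction m generalizing u with
  | zero =>
    obtain rfl : u = v := hm
    exact hu
  | succ m ih =>
    obtain ⟨x, hx, hxv⟩ := hm
    exact ih (hP u x hu hx) hxv

theorem hasWalk_iso (e : G.Adj ≃r H.Adj) (m : ℕ) (u v : V) :
    H.HasWalk m (e u) (e v) ↔ G.HasWalk m u v := by
  induction m generalizing u with
  | zero => exact e.injective.eq_iff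
  | succ m ih =>
    constructor
    · rintro ⟨w, hw, hwv⟩
      obtain ⟨w, rfl⟩ := e.surjective w
      exact ⟨w, e.map_rel_iff.1 hw, (ih w).1 hwv⟩
    · rintro ⟨w, hw, hwv⟩
      exact ⟨e w, e.map_rel_iff.2 hw, (ih w).2 hwv⟩

theorem IsStronglyConnected.of_iso (e : G.Adj ≃r H.Adj) (hG : G.IsStronglyConnected) :
    H.IsStronglyConnected := by
  intro u v
  obtain ⟨u, rfl⟩ := e.surjective u
  obtain ⟨v, rfl⟩ := e.surjective v
  obtain ⟨m, hm⟩ := hG u v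
  exact ⟨m, (hasWalk_iso e m u v).2 hm⟩

theorem distance_iso (e : G.Adj ≃r H.Adj) (u v : V) :
    H.distance (e u) (e v) = G.distance u v := by
  simp only [distance, hasWalk_iso]

theorem distanceSpectralRadius_eq_of_iso [Fintype V] [Fintype W] (e : G.Adj ≃r H.Adj) :
    G.distanceSpectralRadius = H.distanceSpectralRadius := by
  classical
  have h : Matrix.reindexAlgEquiv ℂ ℂ e.toEquiv G.distanceMatrix = H.distanceMatrix := by
    ext u v
    obtain ⟨u, rfl⟩ := e.surjective u
    obtain ⟨v, rfl⟩ := e.surjective v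
    have h1 : ∀ x, e.toEquiv.symm (e x) = x := e.toEquiv.symm_apply_apply
    simp [distanceMatrix, distance_iso, h1]
  have hs : spectrum ℂ H.distanceMatrix = spectrum ℂ G.distanceMatrix := by
    rw [← h, AlgEquiv.spectrum_eq]
  simp only [distanceSpectralRadius, spectralRadius, hs]

theorem distance_self (u : V) : G.distance u u = 0 :=
  Nat.sInf_eq_zero.2 (Or.inl rfl)

theorem distance_le {m : ℕ} {u v : V} (h : G.HasWalk m u v) : G.distance u v ≤ m :=
  Nat.sInf_le h

/-- Strong connectivity excludes the default value 0 of `sInf` on the empty set. -/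
theorem IsStronglyConnected.hasWalk_distance (hG : G.IsStronglyConnected) (u v : V) :
    G.HasWalk (G.distance u v) u v :=
  Nat.sInf_mem (s := {m | G.HasWalk m u v}) (hG u v)

theorem IsStronglyConnected.one_le_distance (hG : G.IsStronglyConnected) {u v : V} (huv : u ≠ v) :
    1 ≤ G.distance u v := by
  by_contra! h
  have hw := hG.hasWalk_distance u v
  rw [Nat.lt_one_iff.1 h] at hw
  exact huv hw

theorem IsStronglyConnected.two_le_distance (hG : G.IsStronglyConnected) {u v : V} (huv : u ≠ v)
    (hadj : ¬ G.Adj u v) : 2 ≤ G.distance u v := by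
  by_contra! h
  have hw := hG.hasWalk_distance u v
  rw [le_antisymm (Nat.lt_succ_iff.1 h) (hG.one_le_distance huv)] at hw
  obtain ⟨w, hw, rfl⟩ := hw
  exact hadj hw

theorem IsStronglyConnected.distance_eq_one (hG : G.IsStronglyConnected) {u v : V} (huv : u ≠ v)
    (hadj : G.Adj u v) : G.distance u v = 1 :=
  le_antisymm (distance_le ⟨v, hadj, rfl⟩) (hG.one_le_distance huv)

end Walks

/-! ### The extremal digraphs and their essential connectivity. -/

section Extremal

variable {n k b : ℕ}

/-- A vertex lies in the middle part. -/
abbrev IsMiddle {U V W : Type*} (x : U ⊕ (V ⊕ W)) : Prop := ∃ v, x = Sum.inr (Sum.inl v)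

/-- A vertex lies in the last part. -/
abbrev IsLast {U V W : Type*} (x : U ⊕ (V ⊕ W)) : Prop := ∃ w, x = Sum.inr (Sum.inr w)

theorem extremal_adj (x y : Fin k ⊕ (Fin b ⊕ Fin (n - k - b))) :
    (extremal n k b).Adj x y ↔ x ≠ y ∧ ¬ (IsLast x ∧ IsMiddle y) := by
  rcases x with x | x | x <;> rcases y with y | y | y <;>
    simp [extremal, join, disjUnion, completeOn, forwardArcs, IsLast, IsMiddle,
      completeBipartiteGraph]

theorem extremal_isLoopless : (extremal n k b).IsLoopless := fun v h =>
  ((extremal_adj v v).1 h).1 rfl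

theorem extremal_walk_two (a : Fin k) {x y : Fin k ⊕ (Fin b ⊕ Fin (n - k - b))}
    (h : IsLast x ∧ IsMiddle y) : (extremal n k b).HasWalk 2 x y := by
  obtain ⟨⟨x, rfl⟩, ⟨y, rfl⟩⟩ := h
  exact ⟨Sum.inl a, by simp [extremal_adj], _, by simp [extremal_adj], rfl⟩

theorem extremal_isStronglyConnected (hk : 1 ≤ k) : (extremal n k b).IsStronglyConnected := by
  intro x y
  by_cases hxy : x = y
  · exact hxy ▸ Reaches.refl x
  by_cases h : IsLast x ∧ IsMiddle y
  · exact ⟨2, extremal_walk_two ⟨0, hk⟩ h⟩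
  · exact Reaches.of_adj ((extremal_adj x y).2 ⟨hxy, h⟩)

/-- The only non-arcs between distinct vertices go from the last part to the middle one, and a
vertex of the first part, present since k ≥ 1, is a midpoint for each. -/
theorem extremal_distance (hk : 1 ≤ k)
    [∀ x : Fin k ⊕ (Fin b ⊕ Fin (n - k - b)), Decidable (IsLast x)]
    [∀ x : Fin k ⊕ (Fin b ⊕ Fin (n - k - b)), Decidable (IsMiddle x)]
    (x y : Fin k ⊕ (Fin b ⊕ Fin (n - k - b))) :
    (extremal n k b).distance x y =
      (1 - if x = y then 1 else 0) + (if IsLast x then 1 else 0) * (if IsMiddle y then 1 else 0) := by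
  have hs := extremal_isStronglyConnected (n := n) (b := b) hk
  by_cases hxy : x = y
  · subst hxy
    rw [distance_self]
    rcases x with x | x | x <;> simp [IsLast, IsMiddle]
  by_cases h : IsLast x ∧ IsMiddle y
  · rw [le_antisymm (distance_le (extremal_walk_two ⟨0, hk⟩ h))
      (hs.two_le_distance hxy fun ha => ((extremal_adj x y).1 ha).2 h)]
    rw [if_neg hxy, if_pos h.1, if_pos h.2]
  · rw [hs.distance_eq_one hxy ((extremal_adj x y).2 ⟨hxy, h⟩), if_neg hxy]
    rcases not_and_or.1 h with h | h <;> simp only [if_neg h] <;> simp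

theorem extremal_isEssentialCut (hb : 2 ≤ b) (hc : 2 ≤ n - k - b) :
    (extremal n k b).IsEssentialCut (Finset.univ.map ⟨Sum.inl, Sum.inl_injective⟩) := by
  set S : Finset (Fin k ⊕ (Fin b ⊕ Fin (n - k - b))) :=
    Finset.univ.map ⟨Sum.inl, Sum.inl_injective⟩
  have hS : ∀ x : Fin b ⊕ Fin (n - k - b), (Sum.inr x : Fin k ⊕ _) ∉ S := by simp [S]
  set G := (extremal n k b).induceOn {v | v ∉ S} with hG
  let p : Fin b ⊕ Fin (n - k - b) → {v | v ∉ S} := fun x => ⟨Sum.inr x, hS x⟩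
  have hadj : ∀ x y, G.Adj (p x) (p y) ↔
      (extremal n k b).Adj (Sum.inr x) (Sum.inr y) := fun x y => Iff.rfl
  let b₀ : Fin b := ⟨0, by omega⟩
  let b₁ : Fin b := ⟨1, by omega⟩
  let c₀ : Fin (n - k - b) := ⟨0, by omega⟩
  let c₁ : Fin (n - k - b) := ⟨1, by omega⟩
  have hb01 : b₀ ≠ b₁ := by simp [b₀, b₁]
  have hc01 : c₀ ≠ c₁ := by simp [c₀, c₁]
  have hB : ∀ i j, i ≠ j → G.Adj (p (Sum.inl i)) (p (Sum.inl j)) := fun i j hij => by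
    rw [hadj, extremal_adj]; simpa [IsLast] using hij
  have hC : ∀ i j, i ≠ j → G.Adj (p (Sum.inr i)) (p (Sum.inr j)) := fun i j hij => by
    rw [hadj, extremal_adj]; simpa [IsMiddle] using hij
  have hcb : ¬ G.Reaches (p (Sum.inr c₀)) (p (Sum.inl b₀)) := by
    intro h
    -- With the first part removed, no arc leaves the last part.
    have := h.mem_of_closed (P := fun v => IsLast v.1) (by
      rintro ⟨u, hu⟩ ⟨v, hv⟩ hl ha
      have ha' := ((extremal_adj u v).1 ha).2
      rcases v with v | v | v
      · exact absurd hv (by simp [S])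
      · exact (ha' ⟨hl, v, rfl⟩).elim
      · exact ⟨v, rfl⟩) ⟨c₀, rfl⟩
    simp [p, IsLast] at this
  refine ⟨_, _, ?_, ⟨p (Sum.inl b₀), rfl⟩, ⟨p (Sum.inr c₀), rfl⟩, ?_, ?_⟩
  · intro h
    have hmem : p (Sum.inr c₀) ∈ {u | G.Reaches (p (Sum.inl b₀)) u ∧ G.Reaches u (p (Sum.inl b₀))} :=
      h ▸ ⟨Reaches.refl _, Reaches.refl _⟩
    exact hcb hmem.2
  · exact ⟨p (Sum.inl b₀), ⟨Reaches.refl _, Reaches.refl _⟩, p (Sum.inl b₁),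
      ⟨Reaches.of_adj (hB _ _ hb01), Reaches.of_adj (hB _ _ hb01.symm)⟩,
      by simpa [p] using hb01, hB _ _ hb01⟩
  · exact ⟨p (Sum.inr c₀), ⟨Reaches.refl _, Reaches.refl _⟩, p (Sum.inr c₁),
      ⟨Reaches.of_adj (hC _ _ hc01), Reaches.of_adj (hC _ _ hc01.symm)⟩,
      by simpa [p] using hc01, hC _ _ hc01⟩

/-- A surviving vertex of the first part has arcs to and from all others, which makes the remaining
digraph strongly connected. Hence a cut contains the whole first part. -/
theorem le_card_of_extremal_isEssentialCut {S : Finset (Fin k ⊕ (Fin b ⊕ Fin (n - k - b)))}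
    (h : (extremal n k b).IsEssentialCut S) : k ≤ S.card := by
  have hsub : Finset.univ.map ⟨Sum.inl, Sum.inl_injective⟩ ⊆ S := by
    intro x hx
    by_contra hxS
    obtain ⟨a, -, rfl⟩ := Finset.mem_map.1 hx
    set G := (extremal n k b).induceOn {v | v ∉ S}
    let a' : {v | v ∉ S} := ⟨Sum.inl a, hxS⟩
    have hto : ∀ u, G.Reaches u a' := fun u => by
      by_cases hu : u = a'
      · exact hu ▸ Reaches.refl _
      · refine Reaches.of_adj ((extremal_adj u.1 a'.1).2 ⟨fun h => hu (Subtype.ext h), ?_⟩)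
        simp [a', IsMiddle]
    have hfrom : ∀ u, G.Reaches a' u := fun u => by
      by_cases hu : a' = u
      · exact hu ▸ Reaches.refl _
      · refine Reaches.of_adj ((extremal_adj a'.1 u.1).2 ⟨fun h => hu (Subtype.ext h), ?_⟩)
        simp [a', IsLast]
    have hall : ∀ u v, G.Reaches u v := fun u v => (hto u).trans (hfrom v)
    obtain ⟨C₁, C₂, hne, ⟨v₁, rfl⟩, ⟨v₂, rfl⟩, -, -⟩ := h
    refine hne (Set.ext fun u => ?_)
    exact ⟨fun _ => ⟨hall _ _, hall _ _⟩, fun _ => ⟨hall _ _, hall _ _⟩⟩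
  simpa using Finset.card_le_card hsub

theorem extremal_memClass (hk : 1 ≤ k) (hb : 2 ≤ b) (hc : 2 ≤ n - k - b) :
    (extremal n k b).MemClass n k where
  loopless := extremal_isLoopless
  card_eq := by simp; omega
  stronglyConnected := extremal_isStronglyConnected hk
  essentialConnectivity_eq := by
    refine le_antisymm (sInf_le ⟨_, extremal_isEssentialCut hb hc, by simp⟩) (le_sInf ?_)
    rintro m ⟨S, hS, rfl⟩
    exact_mod_cast le_card_of_extremal_isEssentialCut hS

end Extremal

/-! ### Embedding into an extremal digraph. -/

section Decomposition

variable {V : Type*} [Fintype V] {n k : ℕ}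

/-- Every member of the class is, up to isomorphism, a spanning subdigraph of some `extremal`. -/
theorem MemClass.exists_iso_le_extremal {G : Digraph V} (hG : G.MemClass n k) :
    ∃ b, 2 ≤ b ∧ 2 ≤ n - k - b ∧
      ∃ H : Digraph (Fin k ⊕ (Fin b ⊕ Fin (n - k - b))), H ≤ extremal n k b ∧
        Nonempty (G.Adj ≃r H.Adj) := by
  classical
  obtain ⟨S, hS, hSk⟩ : ∃ S, G.IsEssentialCut S ∧ S.card = k := by
    have hk := hG.essentialConnectivity_eq
    -- The infimum is the finite value k, so cuts exist and one attains it.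
    have hne : {m : ℕ∞ | ∃ S : Finset V, G.IsEssentialCut S ∧ m = (S.card : ℕ∞)}.Nonempty := by
      by_contra! h
      rw [essentialConnectivity, h, sInf_empty] at hk
      exact ENat.natCast_ne_top k hk.symm
    obtain ⟨S, hS, hc⟩ := csInf_mem hne
    refine ⟨S, hS, ?_⟩
    have : (k : ℕ∞) = S.card := hk.symm.trans hc
    exact_mod_cast this.symm
  set G' := G.induceOn {v | v ∉ S}
  -- Mutual reachability would identify the two components, so some ordering of them works.
  obtain ⟨v₁, v₂, h21, ⟨x₁, hx₁, y₁, hy₁, hxy₁, -⟩, ⟨x₂, hx₂, y₂, hy₂, hxy₂, -⟩⟩ :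
      ∃ v₁ v₂, ¬ G'.Reaches v₂ v₁ ∧
        G'.IsNontrivialOn {u | G'.Reaches v₁ u ∧ G'.Reaches u v₁} ∧
        G'.IsNontrivialOn {u | G'.Reaches v₂ u ∧ G'.Reaches u v₂} := by
    obtain ⟨C₁, C₂, hne, ⟨v₁, rfl⟩, ⟨v₂, rfl⟩, h₁, h₂⟩ := hS
    by_cases h21 : G'.Reaches v₂ v₁
    · refine ⟨v₂, v₁, fun h12 => hne (Set.ext fun u => ?_), h₂, h₁⟩
      exact ⟨fun hu => ⟨h21.trans hu.1, hu.2.trans h12⟩, fun hu => ⟨h12.trans hu.1, hu.2.trans h21⟩⟩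
    · exact ⟨v₁, v₂, h21, h₁, h₂⟩
  let P : {v // v ∉ S} → Prop := fun v => G'.Reaches v₂ v
  have hcard : Fintype.card {v // v ∉ S} = n - k := by
    rw [Fintype.card_subtype_compl, Fintype.card_coe, hSk, hG.card_eq]
  have hsum : Fintype.card {v // ¬ P v} + Fintype.card {v // P v} = n - k := by
    rw [← hcard, ← Fintype.card_congr (Equiv.sumCompl P), Fintype.card_sum, add_comm]
  have hnP : ∀ u, G'.Reaches u v₁ → ¬ P u := fun u hu h => h21 (h.trans hu)
  have hB : 2 ≤ Fintype.card {v // ¬ P v} :=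
    Fintype.one_lt_card_iff.2 ⟨⟨x₁, hnP _ hx₁.2⟩, ⟨y₁, hnP _ hy₁.2⟩, by simpa using hxy₁⟩
  have hC : 2 ≤ Fintype.card {v // P v} :=
    Fintype.one_lt_card_iff.2 ⟨⟨x₂, hx₂.1⟩, ⟨y₂, hy₂.1⟩, by simpa using hxy₂⟩
  refine ⟨Fintype.card {v // ¬ P v}, hB, by omega, ?_⟩
  have hCc : Fintype.card {v // P v} = n - k - Fintype.card {v // ¬ P v} := by omega
  generalize hbdef : Fintype.card {v // ¬ P v} = b at *
  let eA : {v // v ∈ S} ≃ Fin k := Fintype.equivFinOfCardEq (by simpa using hSk)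
  let eB : {v // ¬ P v} ≃ Fin b := Fintype.equivFinOfCardEq hbdef
  let eC : {v // P v} ≃ Fin (n - k - b) := Fintype.equivFinOfCardEq hCc
  let f : Fin k ⊕ (Fin b ⊕ Fin (n - k - b)) ≃ V :=
    ((eA.sumCongr (((Equiv.sumComm _ _).trans (Equiv.sumCompl P)).symm.trans
      (eB.sumCongr eC))).symm).trans (Equiv.sumCompl fun v => v ∈ S)
  have hfB : ∀ i, f (Sum.inr (Sum.inl i)) = ((eB.symm i : {v // v ∉ S}) : V) := fun i => rfl
  have hfC : ∀ i, f (Sum.inr (Sum.inr i)) = ((eC.symm i : {v // v ∉ S}) : V) := fun i => rfl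
  refine ⟨⟨fun x y => G.Adj (f x) (f y)⟩, ?_, ⟨⟨f.symm, by simp⟩⟩⟩
  intro x y hxy
  change G.Adj (f x) (f y) at hxy
  refine (extremal_adj x y).2 ⟨?_, ?_⟩
  · rintro rfl
    exact hG.loopless _ hxy
  · rintro ⟨⟨i, rfl⟩, ⟨j, rfl⟩⟩
    rw [hfB, hfC] at hxy
    have hadj : G'.Adj (eC.symm i : {v // v ∉ S}) (eB.symm j : {v // v ∉ S}) := hxy
    -- The head of an arc leaving the reachable set is itself reachable from `v₂`.
    exact (eB.symm j).2 ((eC.symm i).2.trans (Reaches.of_adj hadj))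

end Decomposition

end Digraph

namespace Digraph

open Matrix

/-! ### Monotonicity of the distance spectral radius under arc deletion. -/

section Comparison

variable {V : Type*}

/-- The distance matrix with real entries. -/
noncomputable def realDistanceMatrix (G : Digraph V) : Matrix V V ℝ :=
  Matrix.of fun u v => (G.distance u v : ℝ)

theorem realDistanceMatrix_nonneg (G : Digraph V) (u v : V) : 0 ≤ G.realDistanceMatrix u v :=
  Nat.cast_nonneg _

theorem distanceMatrix_eq_map (G : Digraph V) :
    G.distanceMatrix = G.realDistanceMatrix.map Complex.ofReal := by
  ext u v
  simp [distanceMatrix, realDistanceMatrix]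

theorem distance_anti {H K : Digraph V} (hHK : H ≤ K) (hH : H.IsStronglyConnected) (u v : V) :
    K.distance u v ≤ H.distance u v := by
  have hmono : ∀ m u, H.HasWalk m u v → K.HasWalk m u v := by
    intro m
    induction m with
    | zero => exact fun u h => h
    | succ m ih => exact fun u ⟨w, hw, h⟩ => ⟨w, hHK hw, ih w h⟩
  exact distance_le (hmono _ u (hH.hasWalk_distance u v))

variable [Fintype V]

theorem distanceSpectralRadius_eq_of_mulVec [Nonempty V] {K : Digraph V} {y : V → ℝ}
    (hy : ∀ v, 0 < y v) {μ : ℝ} (hμ : 0 ≤ μ) (h : K.realDistanceMatrix *ᵥ y = μ • y) :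
    K.distanceSpectralRadius = μ := by
  classical
  rw [distanceSpectralRadius, distanceMatrix_eq_map]
  have h' : ∀ v, (K.realDistanceMatrix *ᵥ y) v = μ * y v := fun v => by rw [h]; rfl
  exact le_antisymm
    (Matrix.spectralRadius_le_of_mulVec_le K.realDistanceMatrix_nonneg hy hμ fun v => (h' v).le)
    (Matrix.le_spectralRadius_of_le_mulVec K.realDistanceMatrix_nonneg hy hμ fun v => (h' v).ge)

/-- Deleting arcs strictly increases the distance spectral radius. -/
theorem lt_distanceSpectralRadius_of_lt {H K : Digraph V} (hHK : H < K) (hK : K.IsLoopless)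
    (hH : H.IsStronglyConnected) (hV : 3 ≤ Fintype.card V) {y : V → ℝ}
    (hy : ∀ v, 0 < y v) {μ : ℝ} (hμ : 0 ≤ μ) (h : K.realDistanceMatrix *ᵥ y = μ • y) :
    μ < H.distanceSpectralRadius := by
  classical
  have h' : ∀ v, (K.realDistanceMatrix *ᵥ y) v = μ * y v := fun v => by rw [h]; rfl
  have hle : ∀ u v, K.realDistanceMatrix u v ≤ H.realDistanceMatrix u v := fun u v =>
    Nat.cast_le.2 (distance_anti hHK.le hH u v)
  obtain ⟨u, v, hKuv, hHuv⟩ : ∃ u v, K.Adj u v ∧ ¬ H.Adj u v := by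
    by_contra! hc
    exact hHK.not_ge fun u v => hc u v
  have huv : u ≠ v := by
    rintro rfl
    exact hK u hKuv
  have hlt : K.realDistanceMatrix u v < H.realDistanceMatrix u v := by
    have h1 : K.distance u v ≤ 1 := distance_le ⟨v, hKuv, rfl⟩
    exact Nat.cast_lt.2 (lt_of_le_of_lt h1 (hH.two_le_distance huv hHuv))
  rw [distanceSpectralRadius, distanceMatrix_eq_map]
  refine Matrix.lt_spectralRadius_of_le_mulVec H.realDistanceMatrix_nonneg
    (fun i j hij => Nat.cast_pos.2 (hH.one_le_distance hij)) hV hy hμ (fun i => ?_) (u := u) ?_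
  · rw [← h' i]
    exact Finset.sum_le_sum fun j _ => mul_le_mul_of_nonneg_right (hle i j) (hy j).le
  · rw [← h' u]
    exact Finset.sum_lt_sum (fun j _ => mul_le_mul_of_nonneg_right (hle u j) (hy j).le)
      ⟨v, Finset.mem_univ v, mul_lt_mul_of_pos_right hlt (hy v)⟩

end Comparison

/-! ### Spectral radius of the extremal digraphs. -/

section ExtremalSpectrum

variable {n k b : ℕ}

open Classical in
/-- A Perron eigenvector of the distance matrix of `extremal n k b` for the eigenvalue `μ`. -/
noncomputable def extremalVec (n k b : ℕ) (μ : ℝ) (x : Fin k ⊕ (Fin b ⊕ Fin (n - k - b))) : ℝ :=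
  μ + 1 + if IsLast x then (b : ℝ) else 0

theorem extremalVec_pos {μ : ℝ} (hμ : 0 ≤ μ) (x : Fin k ⊕ (Fin b ⊕ Fin (n - k - b))) :
    0 < extremalVec n k b μ x := by
  unfold extremalVec
  split_ifs <;> positivity

/-- Put t = μ + 1. The entries are t off the last part and t + b on it, with total nt + b(n-k-b) =
t² and middle sum bt. Rows off the last part give t² - t = μt; rows on it give t² - (t + b) + bt =
μ(t + b). -/
theorem extremal_mulVec_extremalVec (hk : 1 ≤ k) (hn : k + b ≤ n) {μ : ℝ}
    (h : (μ + 1) ^ 2 = n * (μ + 1) + b * (n - k - b)) :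
    (extremal n k b).realDistanceMatrix *ᵥ extremalVec n k b μ = μ • extremalVec n k b μ := by
  classical
  have hc : ((n - k - b : ℕ) : ℝ) = n - k - b := by
    rw [Nat.cast_sub (by omega), Nat.cast_sub (by omega)]
  have hsum : ∑ x, extremalVec n k b μ x = (μ + 1) ^ 2 := by
    simp only [extremalVec, IsLast, Fintype.sum_sum_type]
    simp [hc]
    rw [h]
    ring
  have hmid : ∑ x, (if IsMiddle x then (1 : ℝ) else 0) * extremalVec n k b μ x = b * (μ + 1) := by
    simp only [extremalVec, IsLast, IsMiddle, Fintype.sum_sum_type]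
    simp
    ring
  have hentry : ∀ x y, (extremal n k b).realDistanceMatrix x y =
      1 - (if x = y then 1 else 0) +
        (if IsLast x then 1 else 0) * (if IsMiddle y then (1 : ℝ) else 0) := by
    intro x y
    rw [realDistanceMatrix, Matrix.of_apply, extremal_distance hk]
    split_ifs <;> norm_num
  ext x
  calc ((extremal n k b).realDistanceMatrix *ᵥ extremalVec n k b μ) x
      = ∑ y, (extremalVec n k b μ y - (if x = y then extremalVec n k b μ y else 0) +
          (if IsLast x then 1 else 0) *
            ((if IsMiddle y then (1 : ℝ) else 0) * extremalVec n k b μ y)) := by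
        rw [Matrix.mulVec, dotProduct]
        refine Finset.sum_congr rfl fun y _ => ?_
        rw [hentry]
        split_ifs <;> ring
    _ = (μ + 1) ^ 2 - extremalVec n k b μ x + (if IsLast x then 1 else 0) * (b * (μ + 1)) := by
        rw [Finset.sum_add_distrib, Finset.sum_sub_distrib, ← Finset.mul_sum, hsum, hmid]
        simp
    _ = _ := by
        rw [Pi.smul_apply, smul_eq_mul, extremalVec]
        split_ifs <;> ring

/-- The value of the distance spectral radius of `extremal n k b`, where `p` is the number of
ordered pairs of vertices at distance two. -/
noncomputable def extremalRadius (n : ℕ) (p : ℝ) : ℝ :=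
  ((n : ℝ) - 2 + √(((n : ℝ) - 2) ^ 2 + 4 * (n - 1) + 4 * p)) / 2

theorem extremalRadius_nonneg (hn : 2 ≤ n) (p : ℝ) : 0 ≤ extremalRadius n p := by
  have : (2 : ℝ) ≤ n := by exact_mod_cast hn
  have := Real.sqrt_nonneg (((n : ℝ) - 2) ^ 2 + 4 * (n - 1) + 4 * p)
  unfold extremalRadius
  linarith

theorem extremalRadius_add_one_sq {p : ℝ} (hn : 2 ≤ n) (hp : 0 ≤ p) :
    (extremalRadius n p + 1) ^ 2 = n * (extremalRadius n p + 1) + p := by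
  have : (2 : ℝ) ≤ n := by exact_mod_cast hn
  have hs := Real.sq_sqrt (show 0 ≤ ((n : ℝ) - 2) ^ 2 + 4 * (n - 1) + 4 * p by
    have := sq_nonneg ((n : ℝ) - 2)
    linarith)
  unfold extremalRadius
  linear_combination hs / 4

theorem extremalRadius_strictMonoOn (hn : 2 ≤ n) :
    StrictMonoOn (extremalRadius n) (Set.Ici 0) := by
  intro p hp q _ hpq
  have : (2 : ℝ) ≤ n := by exact_mod_cast hn
  have hp : 0 ≤ p := hp
  have := Real.sqrt_lt_sqrt (show 0 ≤ ((n : ℝ) - 2) ^ 2 + 4 * (n - 1) + 4 * p by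
    have := sq_nonneg ((n : ℝ) - 2)
    linarith) (show _ < ((n : ℝ) - 2) ^ 2 + 4 * (n - 1) + 4 * q by linarith)
  unfold extremalRadius
  linarith

theorem extremal_distanceSpectralRadius (hk : 1 ≤ k) (hb : 1 ≤ b) (hn : k + b ≤ n) :
    (extremal n k b).distanceSpectralRadius = extremalRadius n (b * (n - k - b)) := by
  have : Nonempty (Fin k ⊕ (Fin b ⊕ Fin (n - k - b))) := ⟨Sum.inl ⟨0, hk⟩⟩
  have hp : (0 : ℝ) ≤ b * (n - k - b) := mul_nonneg (by positivity) (by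
    have : (k : ℝ) + b ≤ n := by exact_mod_cast hn
    linarith)
  have h0 := extremalRadius_nonneg (n := n) (by omega) (b * (n - k - b))
  exact distanceSpectralRadius_eq_of_mulVec (extremalVec_pos h0) h0
    (extremal_mulVec_extremalVec hk hn (extremalRadius_add_one_sq (by omega) hp))

theorem extremalRadius_lt_of_lt_extremal (hk : 1 ≤ k) (hb : 2 ≤ b) (hn : k + b ≤ n)
    {H : Digraph (Fin k ⊕ (Fin b ⊕ Fin (n - k - b)))} (hH : H.IsStronglyConnected)
    (hlt : H < extremal n k b) :
    extremalRadius n (b * (n - k - b)) < H.distanceSpectralRadius := by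
  have hp : (0 : ℝ) ≤ b * (n - k - b) := mul_nonneg (by positivity) (by
    have : (k : ℝ) + b ≤ n := by exact_mod_cast hn
    linarith)
  have h0 := extremalRadius_nonneg (n := n) (by omega) (b * (n - k - b))
  exact lt_distanceSpectralRadius_of_lt hlt extremal_isLoopless hH (by simp; omega)
    (extremalVec_pos h0) h0
    (extremal_mulVec_extremalVec hk hn (extremalRadius_add_one_sq (by omega) hp))

end ExtremalSpectrum

end Digraph

/-! ### The main theorem. -/

theorem theorem1p3 (n k : ℕ) (hk : 1 ≤ k) (hn : k + 4 ≤ n) :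
    (Digraph.extremal n k 2).MemClass n k ∧
    (Digraph.extremal n k (n - k - 2)).MemClass n k ∧
    (Digraph.extremal n k 2).distanceSpectralRadius =
      ((n : ℝ) - 2 + √(((n : ℝ) - 2) ^ 2 + 12 * (n : ℝ) - 8 * (k : ℝ) - 20)) / 2 ∧
    (Digraph.extremal n k (n - k - 2)).distanceSpectralRadius =
      ((n : ℝ) - 2 + √(((n : ℝ) - 2) ^ 2 + 12 * (n : ℝ) - 8 * (k : ℝ) - 20)) / 2 ∧
    ∀ (V : Type*) [Fintype V] (G : Digraph V), G.MemClass n k →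
      ((n : ℝ) - 2 + √(((n : ℝ) - 2) ^ 2 + 12 * (n : ℝ) - 8 * (k : ℝ) - 20)) / 2
        ≤ G.distanceSpectralRadius ∧
      (G.distanceSpectralRadius =
          ((n : ℝ) - 2 + √(((n : ℝ) - 2) ^ 2 + 12 * (n : ℝ) - 8 * (k : ℝ) - 20)) / 2 ↔
        G.IsIsomorphic (Digraph.extremal n k 2) ∨
          G.IsIsomorphic (Digraph.extremal n k (n - k - 2))) := by
  have hn' : (k : ℝ) + 4 ≤ n := by exact_mod_cast hn
  have hcast : ((n - k - 2 : ℕ) : ℝ) = n - k - 2 := by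
    rw [Nat.cast_sub (by omega), Nat.cast_sub (by omega)]
    simp
  have hval : ((n : ℝ) - 2 + √(((n : ℝ) - 2) ^ 2 + 12 * (n : ℝ) - 8 * (k : ℝ) - 20)) / 2 =
      Digraph.extremalRadius n (2 * (n - k - 2)) := by
    unfold Digraph.extremalRadius
    congr 3
    ring
  rw [hval]
  have h₁ : (Digraph.extremal n k 2).distanceSpectralRadius =
      Digraph.extremalRadius n (2 * (n - k - 2)) := by
    simpa using Digraph.extremal_distanceSpectralRadius (n := n) (b := 2) hk (by omega) (by omega)
  have h₂ : (Digraph.extremal n k (n - k - 2)).distanceSpectralRadius =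
      Digraph.extremalRadius n (2 * (n - k - 2)) := by
    rw [Digraph.extremal_distanceSpectralRadius hk (by omega) (by omega), hcast]
    congr 1
    ring
  refine ⟨Digraph.extremal_memClass hk le_rfl (by omega),
    Digraph.extremal_memClass hk (by omega) (by omega), h₁, h₂, fun V _ G hG => ?_⟩
  obtain ⟨b, hb, hc, H, hle, ⟨e⟩⟩ := hG.exists_iso_le_extremal
  have hb' : (2 : ℝ) ≤ b := by exact_mod_cast hb
  have hc' : (b : ℝ) + k + 2 ≤ n := by exact_mod_cast (show b + k + 2 ≤ n by omega)
  have hHs := hG.stronglyConnected.of_iso e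
  -- The difference of the two sides is (b - 2)(n - k - 2 - b), a product of nonnegative factors; in
  -- the equality case it vanishes, leaving only the two end values of b.
  have hp : (2 : ℝ) * (n - k - 2) ≤ b * (n - k - b) := by nlinarith
  have hp0 : (0 : ℝ) ≤ 2 * (n - k - 2) := by linarith
  have hmono := (Digraph.extremalRadius_strictMonoOn (n := n) (by omega)).monotoneOn
    hp0 (hp0.trans hp) hp
  have hHG := Digraph.distanceSpectralRadius_eq_of_iso e
  have hbH : Digraph.extremalRadius n (b * (n - k - b)) ≤ G.distanceSpectralRadius := by
    rw [hHG]
    rcases hle.eq_or_lt with rfl | hlt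
    · exact (Digraph.extremal_distanceSpectralRadius hk (by omega) (by omega)).ge
    · exact (Digraph.extremalRadius_lt_of_lt_extremal hk hb (by omega) hHs hlt).le
  refine ⟨hmono.trans hbH, fun heq => ?_, ?_⟩
  -- Equality excludes a proper subdigraph, and then strict monotonicity in p forces p to be
  -- minimal.
  · rcases hle.eq_or_lt with rfl | hlt
    · have hpe : (2 : ℝ) * (n - k - 2) = b * (n - k - b) := by
        by_contra hne
        exact absurd heq (((Digraph.extremalRadius_strictMonoOn (n := n) (by omega)) hp0
          (hp0.trans hp) (lt_of_le_of_ne hp hne)).trans_le hbH).ne'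
      have hfac : ((b : ℝ) - 2) * (b - (n - k - 2)) = 0 := by linear_combination hpe
      rcases mul_eq_zero.1 hfac with h | h
      · obtain rfl : b = 2 := by
          have : (b : ℝ) = 2 := by linarith
          exact_mod_cast this
        exact Or.inl ⟨e⟩
      · obtain rfl : b = n - k - 2 := by
          rw [← hcast] at h
          exact_mod_cast sub_eq_zero.1 h
        exact Or.inr ⟨e⟩
    · have := Digraph.extremalRadius_lt_of_lt_extremal hk hb (by omega) hHs hlt
      rw [← hHG] at this
      exact absurd heq (hmono.trans_lt this).ne'
  · rintro (⟨⟨f⟩⟩ | ⟨⟨f⟩⟩)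
    · exact (Digraph.distanceSpectralRadius_eq_of_iso f).trans h₁
    · exact (Digraph.distanceSpectralRadius_eq_of_iso f).trans h₂
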